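/- Let $\mathbf X=\{X(t)\}_{t\ge0}$ be a Lévy process in $\mathbb R^d$ (that is, $X(0)=0$ almost surely and $\mathbf X$ is stochastically continuous with independent and stationary increments), and let $\mu=\mathcal L(X(1))$ be the law of $X(1)$. Suppose that $\mu$ is full dimensional, i.e. not supported on a proper affine subspace of $\mathbb R^d$. Suppose further that $\mathbf X$ is strictly operator stable with exponent $B\in\mathrm{GL}(\mathbb R^d)$, i.e. for every $t>0$ the vectors $X(t)$ and $t^B X(1)$ have the same distribution, where $t^B:=\exp(B\log t)$. Define $$\mathcal S(\mathbf X)=\big\{A\in\mathrm{GL}(\mathbb R^d):\ \{AX(t)\}_{t\ge0}\text{ and }\{X(t)\}_{t\ge0}\text{ have the same finite-dimensional distributions}\big\},$$ $$\mathcal S(\mu)=\big\{A\in\mathrm{GL}(\mathbb R^d):\ A\mu=\mu*\delta_x\text{ for some }x\in\mathbb R^d\big\},\qquad \mathcal S_0(\mu)=\big\{A\in\mathrm{GL}(\mathbb R^d):\ A\mu=\mu\big\},$$ where $A\mu$ denotes the image of $\mu$ under $A$. If $1$ is not an eigenvalue of $B$, then $$\mathcal S(\mathbf X)=\mathcal S(\mu)\quad\text{and}\quad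 \mathcal S(\mu)=\mathcal S_0(\mu).$$ -/

import Mathlib

open MeasureTheory ProbabilityTheory Filter Topology
open scoped NNReal

namespace OperatorStable

/-! The definitions are made on a finite-dimensional real inner product space `E`, which stands for
`ℝᵈ`; the invertible linear operators `GL(E)` are the elements of `E ≃L[ℝ] E`. -/

section Definitions

variable {E : Type*} [NormedAddCommGroup E] [InnerProductSpace ℝ E] [FiniteDimensional ℝ E]
  [MeasurableSpace E] [BorelSpace E] {Ω : Type*} [MeasurableSpace Ω]

/-- The operator power `t ^ B := exp (B log t)`, for `t > 0`. -/
noncomputable def opPow (t : ℝ) (B : E →L[ℝ] E) : E →L[ℝ] E :=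
  NormedSpace.exp (Real.log t • B)

/-- `X` is a Lévy process in `E` under `P`: it starts at zero, has independent and stationary
increments, and is stochastically continuous. No path regularity is required, so that Lévy processes
with càdlàg paths are included as a special case. -/
structure IsLevyProcess (X : ℝ≥0 → Ω → E) (P : Measure Ω) : Prop where
  measurable : ∀ t, Measurable (X t)
  zero : ∀ᵐ ω ∂P, X 0 ω = 0
  indep_increments : HasIndepIncrements X P
  stationary_increments : ∀ s t : ℝ≥0, IdentDistrib (fun ω => X (s + t) ω - X s ω) (X t) P P
  stoch_continuous : ∀ t : ℝ≥0, TendstoInMeasure P X (𝓝 t) (X t)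

/-- A measure on `E` is full (dimensional) if it is not supported on a proper affine subspace. -/
def IsFull (μ : Measure E) : Prop :=
  ∀ S : AffineSubspace ℝ E, μ (S : Set E)ᶜ = 0 → S = ⊤

/-- `X` is an operator stable Lévy process with exponent `B ∈ GL(E)` and shifts `b`:
`X t` has the same law as `t ^ B X(1) + b(t)` for every `t > 0`. -/
structure IsOperatorStable (X : ℝ≥0 → Ω → E) (P : Measure Ω) (B : E ≃L[ℝ] E)
    (b : ℝ≥0 → E) : Prop where
  levy : IsLevyProcess X P
  scaling : ∀ t : ℝ≥0, 0 < t →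
    IdentDistrib (X t) (fun ω => opPow (t : ℝ) (B : E →L[ℝ] E) (X 1 ω) + b t) P P

/-- `X` is strictly operator stable with exponent `B`: operator stable with `b(t) = 0`. -/
def IsStrictlyOperatorStable (X : ℝ≥0 → Ω → E) (P : Measure Ω) (B : E ≃L[ℝ] E) : Prop :=
  IsOperatorStable X P B (fun _ => 0)

/-- `𝒮(μ)`: all `A ∈ GL(E)` with `A μ = μ ∗ δ_x` for some `x ∈ E`. -/
def symmetryGroup (μ : Measure E) : Set (E ≃L[ℝ] E) :=
  {A | ∃ x : E, μ.map A = μ.conv (Measure.dirac x)}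

/-- `𝒮₀(μ)`: all `A ∈ GL(E)` with `A μ = μ`. -/
def strictSymmetryGroup (μ : Measure E) : Set (E ≃L[ℝ] E) :=
  {A | μ.map A = μ}

/-- `𝒮(X)`: all `A ∈ GL(E)` such that the processes `A X` and `X` have the same
finite-dimensional distributions. -/
def processSymmetryGroup (X : ℝ≥0 → Ω → E) (P : Measure Ω) : Set (E ≃L[ℝ] E) :=
  {A | ∀ I : Finset ℝ≥0,
    IdentDistrib (fun ω => I.restrict (fun t => A (X t ω)))
      (fun ω => I.restrict (fun t => X t ω)) P P}

end Definitions

end OperatorStable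

/-! The affine maps preserving a full law `μ` form a group with uniformly bounded linear parts and
translations, so they share a fixed point `c` (`exists_center`). If `A μ = μ ∗ δ_x`, then `v ↦ A v -
x` preserves `μ`, hence `A c = c + x`.

For a Lévy process, such an `A` shifts the law of `X t` by `t x`
(`IsLevyProcess.map_eq_conv_dirac`). As `X t` has the law of `t ^ B X(1)`, the conjugate of `A` by
`t ^ B` is again a symmetry of `μ`, now with shift `t ^ (-B) (t x)`, and evaluating it at `c` gives
`A (t ^ B c) = t ^ B c + t x`. So `t ^ B c - t c` lies in the space `V` of vectors fixed by every
symmetry, and `V` is stable under `t ^ B`. Differentiating at `t = 1` puts `(B - 1) c` in `V` and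
makes `V` stable under `B - 1`. This operator is injective, hence bijective on `V`, so `c ∈ V` and
`x = 0`.

For the process, a symmetry with zero shift preserves the law of each `X t`, hence of each
increment, hence all finite-dimensional distributions. -/

namespace OperatorStable

set_option linter.unusedSectionVars false

/-! ### Affine symmetries of a full law: boundedness and a common fixed point. -/

section Compactness

open scoped RealInnerProductSpace

variable {E : Type*} [NormedAddCommGroup E] [InnerProductSpace ℝ E]

/-- A bounded group of affine transformations has a common fixed point: the minimizer of
`v ↦ sup_g ‖g v‖ ^ 2`, which is unique by uniform convexity. -/
theorem exists_common_fixed_point [FiniteDimensional ℝ E] (S : Subgroup (E ≃ᵃ[ℝ] E)) {M R : ℝ}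
    (hM : ∀ g ∈ S, ∀ v, ‖g.linear v‖ ≤ M * ‖v‖) (hR : ∀ g ∈ S, ‖g 0‖ ≤ R) :
    ∃ c, ∀ g ∈ S, g c = c := by
  have hdec (g : E ≃ᵃ[ℝ] E) (v : E) : g v = g.linear v + g 0 := by
    have := g.map_vadd 0 v
    simpa using this
  have hsub (g : E ≃ᵃ[ℝ] E) (u v : E) : g u - g v = g.linear (u - v) := by
    rw [hdec g u, hdec g v, map_sub]; abel
  have hbd (v : E) : BddAbove (Set.range fun g : S => ‖(g : E ≃ᵃ[ℝ] E) v‖ ^ 2) := by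
    refine ⟨(M * ‖v‖ + R) ^ 2, ?_⟩
    rintro _ ⟨g, rfl⟩
    have h1 : ‖(g : E ≃ᵃ[ℝ] E) v‖ ≤ M * ‖v‖ + R := by
      rw [hdec]
      exact (norm_add_le _ _).trans (add_le_add (hM g g.2 v) (hR g g.2))
    exact pow_le_pow_left₀ (norm_nonneg _) h1 2
  set Φ : E → ℝ := fun v => ⨆ g : S, ‖(g : E ≃ᵃ[ℝ] E) v‖ ^ 2 with hΦ
  have hle (g : S) (v : E) : ‖(g : E ≃ᵃ[ℝ] E) v‖ ^ 2 ≤ Φ v := le_ciSup (hbd v) g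
  have hnorm (v : E) : ‖v‖ ^ 2 ≤ Φ v := by simpa using hle 1 v
  have hinv (h : S) (v : E) : Φ ((h : E ≃ᵃ[ℝ] E) v) ≤ Φ v := by
    refine ciSup_le fun g => ?_
    simpa using hle (g * h) v
  have hlsc : LowerSemicontinuous Φ := by
    refine lowerSemicontinuous_ciSup hbd fun g => ?_
    have hg : Continuous (g : E ≃ᵃ[ℝ] E) :=
      (g : E ≃ᵃ[ℝ] E).toAffineMap.continuous_of_finiteDimensional
    exact (hg.norm.pow 2).lowerSemicontinuous
  have hΦ0 : 0 ≤ Φ 0 := by simpa using hnorm 0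
  -- Outside this ball `Φ v ≥ ‖v‖ ^ 2 > Φ 0`, so a minimum over the ball is global.
  obtain ⟨c, -, hc⟩ := (hlsc.lowerSemicontinuousOn _).exists_isMinOn
    (s := Metric.closedBall (0 : E) (Real.sqrt (Φ 0))) ⟨0, by simp⟩ (isCompact_closedBall _ _)
  have hmin (v : E) : Φ c ≤ Φ v := by
    by_cases hv : v ∈ Metric.closedBall (0 : E) (Real.sqrt (Φ 0))
    · exact hc hv
    · have h0 : Φ c ≤ Φ 0 := hc (by simp)
      rw [mem_closedBall_zero_iff, not_le] at hv
      have : Φ 0 < ‖v‖ ^ 2 := (Real.sqrt_lt' ((Real.sqrt_nonneg _).trans_lt hv)).1 hv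
      linarith [hnorm v]
  refine ⟨c, fun h hh => ?_⟩
  by_contra hne
  have hd : 0 < ‖h c - c‖ := norm_pos_iff.2 (sub_ne_zero.2 hne)
  have hinvlin (g : S) (v : E) : ‖v‖ ≤ M * ‖(g : E ≃ᵃ[ℝ] E).linear v‖ := by
    have := hM (g⁻¹ : S) (g⁻¹ : S).2 ((g : E ≃ᵃ[ℝ] E).linear v)
    have h2 : ((g⁻¹ : S) : E ≃ᵃ[ℝ] E).linear ((g : E ≃ᵃ[ℝ] E).linear v) = v :=
      (g : E ≃ᵃ[ℝ] E).linear.symm_apply_apply v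
    rwa [h2] at this
  have hMpos : 0 < M := by
    have := hinvlin 1 (h c - c)
    by_contra hM0
    have : M * ‖((1 : S) : E ≃ᵃ[ℝ] E).linear (h c - c)‖ ≤ 0 :=
      mul_nonpos_of_nonpos_of_nonneg (not_lt.1 hM0) (norm_nonneg _)
    linarith
  set m : E := (2⁻¹ : ℝ) • (h c + c) with hm
  -- If `h` moved `c`, the midpoint of `c` and `h c` would beat the minimum: the parallelogram law
  -- gains a fixed amount for all `g` at once, since `g` shrinks lengths at most by the factor `M`.
  have hmid : Φ m ≤ Φ c - (‖h c - c‖ / M) ^ 2 / 4 := by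
    refine ciSup_le fun g => ?_
    set a := (g : E ≃ᵃ[ℝ] E) (h c)
    set b := (g : E ≃ᵃ[ℝ] E) c
    have hgm : (g : E ≃ᵃ[ℝ] E) m = (2⁻¹ : ℝ) • (a + b) := by
      simp only [a, b]
      rw [hdec g m, hdec g (h c), hdec g c, hm, map_smul, map_add]
      module
    have hpar := parallelogram_law_with_norm ℝ a b
    have hgn : ‖(g : E ≃ᵃ[ℝ] E) m‖ = 2⁻¹ * ‖a + b‖ := by
      rw [hgm, norm_smul]; simp
    have h1 : ‖a‖ ^ 2 ≤ Φ c := (hle g (h c)).trans (hinv ⟨h, hh⟩ c)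
    have h2 : ‖b‖ ^ 2 ≤ Φ c := hle g c
    have h3 : ‖h c - c‖ / M ≤ ‖a - b‖ := by
      rw [div_le_iff₀ hMpos, mul_comm, hsub]
      exact hinvlin g _
    have h4 : (‖h c - c‖ / M) ^ 2 ≤ ‖a - b‖ ^ 2 := pow_le_pow_left₀ (by positivity) h3 2
    rw [hgn]
    nlinarith
  have : 0 < (‖h c - c‖ / M) ^ 2 := by positivity
  linarith [hmin m]

theorem continuous_truncation (ξ : E) : Continuous fun p : E × E => min 1 |⟪ξ, p.1 - p.2⟫| := by
  fun_prop

variable [MeasurableSpace E] [BorelSpace E]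

/-- A truncated measure of the dispersion of `μ` in the direction `ξ`. -/
noncomputable def spread (μ : Measure E) (ξ : E) : ℝ :=
  ∫ p, min 1 |⟪ξ, p.1 - p.2⟫| ∂(μ.prod μ)

variable [FiniteDimensional ℝ E] {μ : Measure E}

/-- The group of affine transformations that preserve `μ`. -/
def affineSymmetryGroup (μ : Measure E) : Subgroup (E ≃ᵃ[ℝ] E) where
  carrier := {g | μ.map g = μ}
  one_mem' := by simp [AffineEquiv.coe_one]
  mul_mem' {g h} hg hh := by
    have mg : Measurable g := g.toAffineMap.continuous_of_finiteDimensional.measurable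
    have mh : Measurable h := h.toAffineMap.continuous_of_finiteDimensional.measurable
    simp only [Set.mem_ofPred_eq] at *
    rw [AffineEquiv.coe_mul, ← Measure.map_map mg mh, hh, hg]
  inv_mem' {g} hg := by
    have mg : Measurable g := g.toAffineMap.continuous_of_finiteDimensional.measurable
    have mg' : Measurable (g⁻¹ : E ≃ᵃ[ℝ] E) :=
      (g⁻¹ : E ≃ᵃ[ℝ] E).toAffineMap.continuous_of_finiteDimensional.measurable
    simp only [Set.mem_ofPred_eq] at *
    conv_lhs => rw [← hg, Measure.map_map mg' mg, ← AffineEquiv.coe_mul, inv_mul_cancel]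
    simp [AffineEquiv.coe_one]

theorem mem_affineSymmetryGroup {g : E ≃ᵃ[ℝ] E} :
    g ∈ affineSymmetryGroup μ ↔ μ.map g = μ := Iff.rfl

variable [IsProbabilityMeasure μ]

theorem integrable_truncation (ξ : E) :
    Integrable (fun p : E × E => min 1 |⟪ξ, p.1 - p.2⟫|) (μ.prod μ) := by
  refine Integrable.of_bound (C := 1) (continuous_truncation ξ).aestronglyMeasurable
    (.of_forall fun p => ?_)
  rw [Real.norm_of_nonneg (le_min zero_le_one (abs_nonneg _))]
  exact min_le_left _ _

theorem continuous_spread : Continuous (spread μ) := by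
  refine continuous_of_dominated (bound := fun _ => 1)
    (fun ξ => (continuous_truncation ξ).aestronglyMeasurable) (fun ξ => .of_forall fun p => ?_)
    (integrable_const _) (.of_forall fun p => by fun_prop)
  rw [Real.norm_of_nonneg (le_min zero_le_one (abs_nonneg _))]
  exact min_le_left _ _

theorem spread_le_spread_smul (ξ : E) {a : ℝ} (ha : 1 ≤ a) : spread μ ξ ≤ spread μ (a • ξ) := by
  refine integral_mono (integrable_truncation ξ) (integrable_truncation _) fun p => ?_
  simp only [inner_smul_left, abs_mul, conj_trivial]
  refine min_le_min_left _ (le_mul_of_one_le_left (abs_nonneg _) ?_)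
  rwa [abs_of_nonneg (by linarith)]

/-- Zero spread would put almost all of `μ` in a hyperplane orthogonal to `ξ`. -/
theorem spread_pos (hμ : IsFull μ) {ξ : E} (hξ : ξ ≠ 0) : 0 < spread μ ξ := by
  have hnn : 0 ≤ spread μ ξ := integral_nonneg fun p => le_min zero_le_one (abs_nonneg _)
  refine hnn.lt_of_ne fun h0 => ?_
  have hae : ∀ᵐ p ∂(μ.prod μ), min 1 |⟪ξ, p.1 - p.2⟫| = 0 :=
    (integral_eq_zero_iff_of_nonneg (fun p => le_min zero_le_one (abs_nonneg _))
      (integrable_truncation ξ)).1 h0.symm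
  obtain ⟨y, hy⟩ := (Measure.ae_ae_of_ae_prod hae).exists
  have hy' : ∀ᵐ z ∂μ, z ∈ AffineSubspace.mk' y (ℝ ∙ ξ)ᗮ := by
    filter_upwards [hy] with z hz
    rw [AffineSubspace.mem_mk', Submodule.mem_orthogonal_singleton_iff_inner_right, vsub_eq_sub]
    rcases min_choice 1 |⟪ξ, y - z⟫| with h | h
    · rw [h] at hz; norm_num at hz
    · rw [h, abs_eq_zero] at hz
      rw [← neg_sub, inner_neg_right, hz, neg_zero]
  have htop := hμ (AffineSubspace.mk' y (ℝ ∙ ξ)ᗮ) (mem_ae_iff.1 hy')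
  have h1 : (ℝ ∙ ξ)ᗮ = ⊤ := by
    rw [← AffineSubspace.direction_mk' y (ℝ ∙ ξ)ᗮ, htop, AffineSubspace.direction_top]
  have h2 : ξ ∈ (ℝ ∙ ξ)ᗮ := h1 ▸ Submodule.mem_top
  rw [Submodule.mem_orthogonal_singleton_iff_inner_right, inner_self_eq_zero] at h2
  exact hξ h2

/-- Differences of points do not see the translation part, so the adjoint of the linear part
preserves the spread. -/
theorem spread_comp_linear {g : E ≃ᵃ[ℝ] E} (hg : g ∈ affineSymmetryGroup μ) {ξ η : E}
    (h : ∀ v, ⟪η, v⟫ = ⟪ξ, g.linear v⟫) : spread μ η = spread μ ξ := by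
  have mg : Measurable g := g.toAffineMap.continuous_of_finiteDimensional.measurable
  have hprod : (μ.prod μ).map (Prod.map g g) = μ.prod μ := by
    rw [← Measure.map_prod_map _ _ mg mg, mem_affineSymmetryGroup.1 hg]
  unfold spread
  conv_rhs => rw [← hprod]
  rw [integral_map (mg.prodMap mg).aemeasurable (continuous_truncation ξ).aestronglyMeasurable]
  refine integral_congr_ae (.of_forall fun p => ?_)
  have : g p.1 - g p.2 = g.linear (p.1 - p.2) := by
    simpa using (g.toAffineMap.linearMap_vsub p.1 p.2).symm
  simp only [Prod.map_fst, Prod.map_snd, this, h]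

/-- The spread is at least some `ε > 0` off the open unit ball and below `ε` near zero. The adjoint
of the linear part preserves it, hence sends a fixed small ball into the unit ball. -/
theorem exists_linear_bound (hμ : IsFull μ) :
    ∃ M, ∀ g ∈ affineSymmetryGroup μ, ∀ v, ‖g.linear v‖ ≤ M * ‖v‖ := by
  obtain ⟨ε, hε, hle⟩ : ∃ ε > 0, ∀ ξ : E, 1 ≤ ‖ξ‖ → ε ≤ spread μ ξ := by
    have key : ∃ ε > 0, ∀ ξ ∈ Metric.sphere (0 : E) 1, ε ≤ spread μ ξ := by
      rcases (Metric.sphere (0 : E) 1).eq_empty_or_nonempty with h | h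
      · exact ⟨1, one_pos, by simp [h]⟩
      · obtain ⟨ξ₀, h₀, hmin⟩ := (isCompact_sphere (0 : E) 1).exists_isMinOn h
          (continuous_spread (μ := μ)).continuousOn
        refine ⟨spread μ ξ₀, spread_pos hμ ?_, fun ξ hξ => hmin hξ⟩
        rintro rfl
        simp at h₀
    obtain ⟨ε, hε, hle⟩ := key
    refine ⟨ε, hε, fun ξ hξ => ?_⟩
    have hpos : 0 < ‖ξ‖ := one_pos.trans_le hξ
    have h1 := spread_le_spread_smul (μ := μ) (‖ξ‖⁻¹ • ξ) hξ
    rw [smul_smul, mul_inv_cancel₀ hpos.ne', one_smul] at h1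
    refine (hle _ ?_).trans h1
    simp [norm_smul, hpos.ne']
  have h0 : spread μ (0 : E) = 0 := by simp [spread]
  obtain ⟨r, hr, hsmall⟩ := Metric.continuous_iff.1 (continuous_spread (μ := μ)) 0 ε hε
  refine ⟨(r / 2)⁻¹, fun g hg v => ?_⟩
  set L : E →L[ℝ] E := LinearMap.toContinuousLinearMap (g.linear : E →ₗ[ℝ] E) with hL
  have hLv (v : E) : L v = g.linear v := rfl
  by_cases hz : g.linear v = 0
  · rw [hz, norm_zero]; positivity
  have hpos : 0 < ‖g.linear v‖ := norm_pos_iff.2 hz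
  set ξ : E := (r / 2 * ‖g.linear v‖⁻¹) • g.linear v with hξ
  have hnξ : ‖ξ‖ = r / 2 := by
    rw [hξ, norm_smul, norm_mul, norm_inv, norm_norm, Real.norm_of_nonneg (by positivity),
      mul_assoc, inv_mul_cancel₀ hpos.ne', mul_one]
  have hs : spread μ (L.adjoint ξ) = spread μ ξ :=
    spread_comp_linear hg fun v => by rw [ContinuousLinearMap.adjoint_inner_left, hLv]
  have hlt : spread μ ξ < ε := by
    have := hsmall ξ (by rw [dist_zero_right, hnξ]; linarith)
    rw [h0, Real.dist_eq, sub_zero] at this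
    exact (le_abs_self _).trans_lt this
  have hadj : ‖L.adjoint ξ‖ < 1 := by
    by_contra hcon
    have := hle _ (not_lt.1 hcon)
    linarith
  have h1 : ⟪ξ, g.linear v⟫ = r / 2 * ‖g.linear v‖ := by
    rw [hξ, inner_smul_left, real_inner_self_eq_norm_sq]
    simp only [conj_trivial]
    field_simp
  have h2 : ⟪ξ, g.linear v⟫ ≤ ‖v‖ := by
    rw [← hLv, ← ContinuousLinearMap.adjoint_inner_left]
    refine (real_inner_le_norm _ _).trans ?_
    nlinarith [norm_nonneg v]
  rw [h1] at h2
  rw [inv_mul_eq_div, le_div_iff₀ (by positivity)]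
  linarith

/-- A ball of mass above one half meets its preimage under `g`, which gives a point `y` with both
`y` and `g y` in the ball; then `g 0 = g y - g.linear y`. -/
theorem exists_translation_bound (hμ : IsFull μ) :
    ∃ R, ∀ g ∈ affineSymmetryGroup μ, ‖g 0‖ ≤ R := by
  obtain ⟨M, hM⟩ := exists_linear_bound hμ
  obtain ⟨r, hr⟩ : ∃ r : ℕ, μ (Metric.closedBall 0 r)ᶜ < 2⁻¹ := by
    have hanti : Antitone fun r : ℕ => (Metric.closedBall (0 : E) r)ᶜ := fun a b hab =>
      Set.compl_subset_compl.2 (Metric.closedBall_subset_closedBall (by exact_mod_cast hab))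
    have hlim := tendsto_measure_iInter_atTop (μ := μ)
      (fun r : ℕ => (Metric.isClosed_closedBall (x := (0 : E))
        (ε := r)).measurableSet.compl.nullMeasurableSet)
      hanti ⟨0, measure_ne_top _ _⟩
    have hemp : (⋂ r : ℕ, (Metric.closedBall (0 : E) r)ᶜ) = ∅ := by
      rw [← Set.compl_iUnion, Metric.iUnion_closedBall_nat, Set.compl_univ]
    rw [hemp, measure_empty] at hlim
    exact (hlim.eventually (gt_mem_nhds (by simp))).exists
  refine ⟨r + |M| * r, fun g hg => ?_⟩
  have mg : Measurable g := g.toAffineMap.continuous_of_finiteDimensional.measurable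
  have h1 : μ (g ⁻¹' (Metric.closedBall 0 r)ᶜ) < 2⁻¹ := by
    rw [← Measure.map_apply mg Metric.isClosed_closedBall.measurableSet.compl,
      mem_affineSymmetryGroup.1 hg]
    exact hr
  have h2 : μ ((Metric.closedBall 0 r)ᶜ ∪ g ⁻¹' (Metric.closedBall 0 r)ᶜ) < 1 := by
    refine (measure_union_le _ _).trans_lt ((ENNReal.add_lt_add hr h1).trans_eq ?_)
    exact ENNReal.inv_two_add_inv_two
  obtain ⟨y, hy⟩ : ∃ y, y ∉ (Metric.closedBall (0 : E) r)ᶜ ∪ g ⁻¹' (Metric.closedBall 0 r)ᶜ := by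
    by_contra! hcon
    rw [Set.eq_univ_of_forall hcon, measure_univ] at h2
    exact h2.false
  simp only [Set.mem_union, Set.mem_compl_iff, Set.mem_preimage, not_or, not_not,
    mem_closedBall_zero_iff] at hy
  have hdec : g 0 = g y - g.linear y := by
    have := g.map_vadd 0 y
    simp only [vadd_eq_add, add_zero] at this
    rw [this]; abel
  rw [hdec]
  refine (norm_sub_le _ _).trans (add_le_add hy.2 ((hM g hg y).trans ?_))
  exact (mul_le_mul_of_nonneg_right (le_abs_self M) (norm_nonneg _)).trans
    (mul_le_mul_of_nonneg_left hy.1 (abs_nonneg _))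

/-- A full probability measure has a center: a point fixed by all its affine symmetries. -/
theorem exists_center (hμ : IsFull μ) : ∃ c, ∀ g ∈ affineSymmetryGroup μ, g c = c := by
  obtain ⟨M, hM⟩ := exists_linear_bound hμ
  obtain ⟨R, hR⟩ := exists_translation_bound hμ
  exact exists_common_fixed_point _ hM hR

end Compactness

/-! ### Lévy processes: finite-dimensional laws and symmetries at all times. -/

section Levy

open scoped RealInnerProductSpace

variable {E : Type*} [NormedAddCommGroup E] [InnerProductSpace ℝ E] [FiniteDimensional ℝ E]
  [MeasurableSpace E] [BorelSpace E] {Ω : Type*} [MeasurableSpace Ω]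

/-- The finite-dimensional distributions of a process with independent increments that starts at
zero are determined by the laws of its increments. -/
theorem identDistrib_restrict_of_increments {P : Measure Ω} {X Y : ℝ≥0 → Ω → E}
    (hX : HasIndepIncrements X P) (hY : HasIndepIncrements Y P)
    (hX0 : ∀ᵐ ω ∂P, X 0 ω = 0) (hY0 : ∀ᵐ ω ∂P, Y 0 ω = 0)
    (h : ∀ s t : ℝ≥0, s ≤ t →
      IdentDistrib (fun ω => X t ω - X s ω) (fun ω => Y t ω - Y s ω) P P) (I : Finset ℝ≥0) :
    IdentDistrib (fun ω => I.restrict (fun t => X t ω)) (fun ω => I.restrict (fun t => Y t ω))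
      P P := by
  obtain ⟨τ, N, hmono, hzero, hτ⟩ : ∃ (τ : ℕ → ℝ≥0) (N : ℕ), Monotone τ ∧ τ 0 = 0 ∧
      ∀ k ∈ I, ∃ i ≤ N, τ i = k := by
    induction I using Finset.induction_on_max with
    | empty => exact ⟨fun _ => 0, 0, monotone_const, rfl, by simp⟩
    | insert a I ha ih =>
      obtain ⟨τ, N, hmono, hzero, hτ⟩ := ih
      -- Capping at `a` keeps the sequence monotone and does not alter the times in `I`, all below
      -- `a`.
      refine ⟨fun i => if i ≤ N then min (τ i) a else a, N + 1, ?_, by simp [hzero], ?_⟩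
      · intro i j hij
        simp only
        split_ifs with h1 h2
        · exact min_le_min_right _ (hmono hij)
        · exact min_le_right _ _
        · omega
        · exact le_rfl
      · intro k hk
        rcases Finset.mem_insert.1 hk with rfl | hk
        · exact ⟨N + 1, le_rfl, by simp⟩
        · obtain ⟨i, hi, rfl⟩ := hτ k hk
          exact ⟨i, hi.trans (Nat.le_succ N), by simp [hi, (ha _ hk).le]⟩
  choose! idx _ hidx using hτ
  have hpi := IdentDistrib.pi (fun i => h _ _ (hmono (Nat.le_succ i))) (hX.nat hmono) (hY.nat hmono)
  have hmeas : Measurable fun (d : ℕ → E) (k : I) => ∑ i ∈ Finset.range (idx k), d i :=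
    measurable_pi_lambda _ fun k => Finset.measurable_sum _ fun i _ => measurable_pi_apply i
  have hcomp := hpi.comp hmeas
  have hsum (Z : ℝ≥0 → Ω → E) (hZ0 : ∀ᵐ ω ∂P, Z 0 ω = 0) :
      ((fun (d : ℕ → E) (k : I) => ∑ i ∈ Finset.range (idx k), d i) ∘
        fun ω i => Z (τ (i + 1)) ω - Z (τ i) ω) =ᵐ[P] fun ω => I.restrict (fun t => Z t ω) := by
    filter_upwards [hZ0] with ω hω
    funext k
    simp only [Function.comp_apply, Finset.restrict]
    rw [Finset.sum_range_sub (fun i => Z (τ i) ω), hzero, hω, sub_zero, hidx k k.2]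
  refine ⟨hcomp.aemeasurable_fst.congr (hsum X hX0), hcomp.aemeasurable_snd.congr (hsum Y hY0), ?_⟩
  rw [← Measure.map_congr (hsum X hX0), ← Measure.map_congr (hsum Y hY0)]
  exact hcomp.map_eq

theorem charFun_map_clm (μ : Measure E) (L : E →L[ℝ] E) (ξ : E) :
    charFun (μ.map L) ξ = charFun μ (L.adjoint ξ) := by
  rw [charFun_apply, charFun_apply, integral_map (by fun_prop) (by fun_prop)]
  simp only [ContinuousLinearMap.adjoint_inner_right]

theorem map_eq_conv_dirac_iff {μ : Measure E} [IsProbabilityMeasure μ] {L : E →L[ℝ] E} {x : E} :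
    μ.map L = μ.conv (Measure.dirac x) ↔
      ∀ ξ, charFun μ (L.adjoint ξ) = charFun μ ξ * Complex.exp (⟪x, ξ⟫ * Complex.I) := by
  have hL : IsProbabilityMeasure (μ.map L) :=
    Measure.isProbabilityMeasure_map L.continuous.measurable.aemeasurable
  constructor
  · intro h ξ
    rw [← charFun_map_clm, h, charFun_conv, charFun_dirac]
  · intro h
    refine Measure.ext_of_charFun (funext fun ξ => ?_)
    rw [charFun_map_clm, h, charFun_conv, charFun_dirac]

variable {P : Measure Ω} [IsProbabilityMeasure P] {X : ℝ≥0 → Ω → E}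

theorem IsLevyProcess.isProbabilityMeasure_map (hX : IsLevyProcess X P) (t : ℝ≥0) :
    IsProbabilityMeasure (P.map (X t)) :=
  Measure.isProbabilityMeasure_map (hX.measurable t).aemeasurable

theorem IsLevyProcess.charFun_zero_time (hX : IsLevyProcess X P) (ξ : E) :
    charFun (P.map (X 0)) ξ = 1 := by
  have : P.map (X 0) = Measure.dirac 0 := by
    rw [Measure.map_congr (g := fun _ => (0 : E)) hX.zero, Measure.map_const]
    simp
  rw [this, charFun_dirac]
  simp

theorem IsLevyProcess.charFun_add (hX : IsLevyProcess X P) (s t : ℝ≥0) (ξ : E) :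
    charFun (P.map (X (s + t))) ξ = charFun (P.map (X s)) ξ * charFun (P.map (X t)) ξ := by
  have hind : IndepFun (X s) (X (s + t) - X s) P :=
    hX.indep_increments.indepFun_eval_sub zero_le le_self_add hX.zero
  have h := hind.charFun_map_add_eq_mul (hX.measurable s).aemeasurable
    ((hX.measurable _).sub (hX.measurable s)).aemeasurable
  rw [add_sub_cancel] at h
  rw [h, Pi.mul_apply]
  congr 2
  exact (hX.stationary_increments s t).map_eq

theorem IsLevyProcess.charFun_nsmul (hX : IsLevyProcess X P) (n : ℕ) (t : ℝ≥0) (ξ : E) :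
    charFun (P.map (X (n * t))) ξ = charFun (P.map (X t)) ξ ^ n := by
  induction n with
  | zero => simp [hX.charFun_zero_time]
  | succ n ih => rw [Nat.cast_succ, add_mul, one_mul, hX.charFun_add, ih, pow_succ]

theorem IsLevyProcess.continuous_charFun_time (hX : IsLevyProcess X P) (ξ : E) :
    Continuous fun t => charFun (P.map (X t)) ξ := by
  refine continuous_iff_continuousAt.2 fun t => ?_
  have h := ((hX.stoch_continuous t).tendstoInDistribution_of_aemeasurable
    (fun s => (hX.measurable s).aemeasurable) (hX.measurable t).aemeasurable).tendsto
  simp only [ContinuousAt, charFun_eq_integral_innerProbChar]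
  exact (ProbabilityMeasure.tendsto_iff_forall_integral_rclike_tendsto ℂ).1 h
    (BoundedContinuousFunction.innerProbChar ξ)

/-- The value is an `(n + 1)`-th power of the value at time `t / (n + 1)`, which tends to `1`. -/
theorem IsLevyProcess.charFun_ne_zero (hX : IsLevyProcess X P) (t : ℝ≥0) (ξ : E) :
    charFun (P.map (X t)) ξ ≠ 0 := by
  have hlim : Tendsto (fun n : ℕ => t / ((n : ℝ≥0) + 1)) atTop (𝓝 0) := by
    have := (tendsto_one_div_add_atTop_nhds_zero_nat (𝕜 := ℝ≥0)).const_mul t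
    simpa [div_eq_mul_inv] using this
  have h := ((hX.continuous_charFun_time ξ).tendsto 0).comp hlim
  rw [hX.charFun_zero_time] at h
  obtain ⟨n, hn⟩ := (h.eventually_ne one_ne_zero).exists
  have h1 := hX.charFun_nsmul (n + 1) (t / ((n : ℝ≥0) + 1)) ξ
  rw [Nat.cast_succ, mul_div_cancel₀ _ (by positivity)] at h1
  rw [h1]
  exact pow_ne_zero _ hn

/-- A symmetry of the law of `X 1` with shift `x` is a symmetry of the law of `X (1 / n)` with shift
`x / n`: the quotient of the two characteristic functions is a continuous root of unity. -/
theorem IsLevyProcess.charFun_symmetry_inv_nat (hX : IsLevyProcess X P) {L : E →L[ℝ] E} {x : E}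
    (h : ∀ ξ, charFun (P.map (X 1)) (L.adjoint ξ) =
      charFun (P.map (X 1)) ξ * Complex.exp (⟪x, ξ⟫ * Complex.I)) {n : ℕ} (hn : n ≠ 0) (ξ : E) :
    charFun (P.map (X (n : ℝ≥0)⁻¹)) (L.adjoint ξ) =
      charFun (P.map (X (n : ℝ≥0)⁻¹)) ξ * Complex.exp (⟪(n : ℝ)⁻¹ • x, ξ⟫ * Complex.I) := by
  have hprob := hX.isProbabilityMeasure_map (n : ℝ≥0)⁻¹
  have hn' : (n : ℝ≥0) ≠ 0 := Nat.cast_ne_zero.2 hn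
  have hpow (η : E) : charFun (P.map (X (n : ℝ≥0)⁻¹)) η ^ n = charFun (P.map (X 1)) η := by
    rw [← hX.charFun_nsmul, mul_inv_cancel₀ hn']
  set φ := charFun (P.map (X (n : ℝ≥0)⁻¹)) with hφ
  have hcont : Continuous φ := continuous_charFun
  set d : E → ℂ := fun η => φ η * Complex.exp (⟪(n : ℝ)⁻¹ • x, η⟫ * Complex.I) with hd
  have hd0 (η : E) : d η ≠ 0 := mul_ne_zero (hX.charFun_ne_zero _ _) (Complex.exp_ne_zero _)
  have hdpow (η : E) : d η ^ n = φ (L.adjoint η) ^ n := by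
    rw [hd]
    simp only
    rw [mul_pow, hpow, hpow, h, ← Complex.exp_nat_mul, inner_smul_left]
    congr 2
    have : (n : ℂ) ≠ 0 := Nat.cast_ne_zero.2 hn
    simp only [conj_trivial]
    push_cast
    field_simp
  have hdc : Continuous d := by fun_prop
  have hr : Continuous fun η => φ (L.adjoint η) / d η :=
    (hcont.comp (L.adjoint).continuous).div hdc hd0
  have hmaps : Set.MapsTo (fun η => φ (L.adjoint η) / d η) Set.univ {z : ℂ | z ^ n = 1} := by
    intro η _
    change (φ (L.adjoint η) / d η) ^ n = 1
    rw [div_pow, hdpow, div_self]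
    rw [← hdpow]
    exact pow_ne_zero _ (hd0 η)
  have hfin : {z : ℂ | z ^ n = 1}.Finite := by
    refine (Polynomial.nthRoots n (1 : ℂ)).toFinset.finite_toSet.subset fun z hz => ?_
    simpa [Polynomial.mem_nthRoots (Nat.pos_of_ne_zero hn)] using hz
  have hdisc : IsDiscrete {z : ℂ | z ^ n = 1} := hfin.isDiscrete
  have hconst := isPreconnected_univ.constant_of_mapsTo hdisc hr.continuousOn hmaps
    (Set.mem_univ ξ) (Set.mem_univ 0)
  have h0 : φ (L.adjoint 0) / d 0 = 1 := by
    simp [hd, hφ]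
  exact (div_eq_one_iff_eq (hd0 ξ)).1 (hconst.trans h0)

/-- Times `1 / n` give rational times by taking powers; density and continuity in time give the
rest. -/
theorem IsLevyProcess.map_eq_conv_dirac (hX : IsLevyProcess X P) {L : E →L[ℝ] E} {x : E}
    (h : (P.map (X 1)).map L = (P.map (X 1)).conv (Measure.dirac x)) (t : ℝ≥0) :
    (P.map (X t)).map L = (P.map (X t)).conv (Measure.dirac (t • x)) := by
  have := hX.isProbabilityMeasure_map
  rw [map_eq_conv_dirac_iff] at h ⊢
  intro ξ
  have hrat (q : ℚ≥0) : charFun (P.map (X (q : ℝ≥0))) (L.adjoint ξ) =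
      charFun (P.map (X (q : ℝ≥0))) ξ *
        Complex.exp (⟪((q : ℝ≥0) : ℝ) • x, ξ⟫ * Complex.I) := by
    have hq : (q : ℝ≥0) = q.num * (q.den : ℝ≥0)⁻¹ := by
      rw [NNRat.cast_def, div_eq_mul_inv]
    rw [hq, hX.charFun_nsmul, hX.charFun_nsmul, hX.charFun_symmetry_inv_nat h q.den_ne_zero, mul_pow,
      ← Complex.exp_nat_mul]
    congr 2
    simp only [inner_smul_left, conj_trivial]
    push_cast
    ring
  have hdense : DenseRange ((↑) : ℚ≥0 → ℝ≥0) := by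
    have hs : Function.Surjective Real.toNNReal := fun r => ⟨r, Real.toNNReal_coe⟩
    refine (hs.denseRange.comp (Rat.denseRange_cast (𝕜 := ℝ)) continuous_real_toNNReal).mono ?_
    rintro _ ⟨q, rfl⟩
    refine ⟨q.toNNRat, NNReal.coe_injective ?_⟩
    rcases le_total 0 q with hq | hq
    · lift q to ℚ≥0 using hq
      have hq0 : (0 : ℝ) ≤ q := by positivity
      rw [Function.comp_apply, Real.coe_toNNReal', Rat.cast_nnratCast, max_eq_left hq0,
        NNRat.toNNRat_coe]
      rfl
    · simp [hq]
  have hexp : Continuous fun t : ℝ≥0 => Complex.exp (⟪(t : ℝ) • x, ξ⟫ * Complex.I) := by fun_prop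
  have := hdense.equalizer (hX.continuous_charFun_time (L.adjoint ξ))
    ((hX.continuous_charFun_time ξ).mul hexp) (funext hrat)
  exact congrFun this t

end Levy

/-! ### Operator powers, vanishing of the shift, and symmetries of the process. -/

section Symmetry

variable {E : Type*} [NormedAddCommGroup E] [InnerProductSpace ℝ E] [FiniteDimensional ℝ E]

theorem opPow_exp (s : ℝ) (B : E →L[ℝ] E) : opPow (Real.exp s) B = NormedSpace.exp (s • B) := by
  rw [opPow, Real.log_exp]

theorem opPow_inv_apply_opPow (t : ℝ) (B : E →L[ℝ] E) (v : E) :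
    opPow t⁻¹ B (opPow t B v) = v := by
  have h : opPow t⁻¹ B * opPow t B = 1 := by
    have hc : Commute (Real.log t⁻¹ • B) (Real.log t • B) :=
      ((Commute.refl B).smul_left _).smul_right _
    let : NormedAlgebra ℚ (E →L[ℝ] E) := NormedAlgebra.restrictScalars ℚ ℝ (E →L[ℝ] E)
    rw [opPow, opPow, ← NormedSpace.exp_add_of_commute hc, ← add_smul, Real.log_inv,
      neg_add_cancel, zero_smul, NormedSpace.exp_zero]
  exact DFunLike.congr_fun h v

/-- The operator power `t ^ B` as an element of `GL(E)`. -/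
noncomputable def opPowEquiv (t : ℝ) (B : E →L[ℝ] E) : E ≃L[ℝ] E :=
  ContinuousLinearEquiv.equivOfInverse (opPow t B) (opPow t⁻¹ B) (opPow_inv_apply_opPow t B)
    fun v => by simpa using opPow_inv_apply_opPow t⁻¹ B v

theorem opPowEquiv_apply (t : ℝ) (B : E →L[ℝ] E) (v : E) : opPowEquiv t B v = opPow t B v := rfl

theorem hasDerivAt_opPow_exp_apply (B : E →L[ℝ] E) (v : E) :
    HasDerivAt (fun s : ℝ => opPow (Real.exp s) B v) (B v) 0 := by
  simp only [opPow_exp]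
  have h := (hasDerivAt_exp_smul_const (𝕂 := ℝ) B (0 : ℝ)).clm_apply (hasDerivAt_const (0 : ℝ) v)
  simpa using h

theorem hasDerivAt_mem_submodule (V : Submodule ℝ E) {f : ℝ → E} {f' : E} {s : ℝ}
    (hf : ∀ u, f u ∈ V) (h : HasDerivAt f f' s) : f' ∈ V := by
  refine V.closed_of_finiteDimensional.mem_of_tendsto (hasDerivAt_iff_tendsto_slope.1 h)
    (.of_forall fun u => ?_)
  exact V.smul_mem _ (V.sub_mem (hf u) (hf s))

variable [MeasurableSpace E] [BorelSpace E]

theorem exists_affineSymmetry {μ : Measure E} [SFinite μ] {A : E ≃L[ℝ] E} {x : E}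
    (h : μ.map A = μ.conv (Measure.dirac x)) :
    ∃ g ∈ affineSymmetryGroup μ, ∀ v, g v = A v - x := by
  refine ⟨A.toLinearEquiv.toAffineEquiv.trans (AffineEquiv.constVAdd ℝ E (-x)), ?_, fun v => ?_⟩
  · rw [mem_affineSymmetryGroup]
    have hfun : ⇑(A.toLinearEquiv.toAffineEquiv.trans (AffineEquiv.constVAdd ℝ E (-x))) =
        (fun v => v - x) ∘ A := by
      funext v
      simp [sub_eq_neg_add]
    rw [hfun, ← Measure.map_map (by fun_prop) (by fun_prop), h, Measure.conv_dirac,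
      Measure.map_map (by fun_prop) (by fun_prop)]
    have : (fun v => v - x) ∘ (fun v => v + x) = (id : E → E) := by funext v; simp
    rw [this, Measure.map_id]
  · simp [sub_eq_neg_add]

variable {Ω : Type*} [MeasurableSpace Ω] {P : Measure Ω} [IsProbabilityMeasure P]
  {X : ℝ≥0 → Ω → E} {B : E ≃L[ℝ] E}

/-- The operators `t ^ B` normalize the group of symmetries of the law of `X 1`. -/
theorem IsStrictlyOperatorStable.map_conj_eq_conv_dirac (hX : IsStrictlyOperatorStable X P B)
    {A : E ≃L[ℝ] E} {x : E} (h : (P.map (X 1)).map A = (P.map (X 1)).conv (Measure.dirac x))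
    {t : ℝ≥0} (ht : 0 < t) :
    (P.map (X 1)).map (((opPowEquiv t B).trans A).trans (opPowEquiv t B).symm) =
      (P.map (X 1)).conv (Measure.dirac ((opPowEquiv t (B : E →L[ℝ] E)).symm (t • x))) := by
  have hprob := hX.levy.isProbabilityMeasure_map
  have hprob1 := hprob 1
  set μ := P.map (X 1) with hμ
  set T := opPowEquiv (t : ℝ) (B : E →L[ℝ] E) with hT
  have hlaw : P.map (X t) = μ.map T := by
    rw [(hX.scaling t ht).map_eq, hμ, Measure.map_map T.continuous.measurable (hX.levy.measurable 1)]
    congr 1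
    funext ω
    simp [hT, opPowEquiv_apply]
  have h1 := hX.levy.map_eq_conv_dirac (L := (A : E →L[ℝ] E)) h t
  have := hprob t
  clear_value μ
  rw [Measure.conv_dirac, hlaw] at h1
  have h2 := congrArg (Measure.map T.symm) h1
  rw [Measure.map_map (by fun_prop) (by fun_prop), Measure.map_map (by fun_prop) (by fun_prop),
    Measure.map_map (by fun_prop) (by fun_prop), Measure.map_map (by fun_prop) (by fun_prop)] at h2
  rw [Measure.conv_dirac]
  convert h2 using 2 <;> (funext v; simp)

/-- If `1` is not an eigenvalue of the exponent, every symmetry of the law of `X 1` has shift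
zero. -/
theorem IsStrictlyOperatorStable.shift_eq_zero (hX : IsStrictlyOperatorStable X P B)
    (hfull : IsFull (P.map (X 1)))
    (hB : ¬ Module.End.HasEigenvalue ((B : E →L[ℝ] E) : E →ₗ[ℝ] E) (1 : ℝ))
    {A : E ≃L[ℝ] E} {x : E} (hA : (P.map (X 1)).map A = (P.map (X 1)).conv (Measure.dirac x)) :
    x = 0 := by
  have hprob := hX.levy.isProbabilityMeasure_map 1
  obtain ⟨c, hc⟩ := exists_center hfull
  have hcenter {A : E ≃L[ℝ] E} {x : E}
      (h : (P.map (X 1)).map A = (P.map (X 1)).conv (Measure.dirac x)) : A c = c + x := by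
    obtain ⟨g, hg, hgv⟩ := exists_affineSymmetry h
    rw [← sub_eq_iff_eq_add, ← hgv, hc g hg]
  let V : Submodule ℝ E :=
    { carrier := {v | ∀ (A : E ≃L[ℝ] E) (x : E),
        (P.map (X 1)).map A = (P.map (X 1)).conv (Measure.dirac x) → A v = v}
      add_mem' := fun {u v} hu hv A x h => by rw [map_add, hu A x h, hv A x h]
      zero_mem' := fun A x _ => map_zero A
      smul_mem' := fun a v hv A x h => by rw [map_smul, hv A x h] }
  have hVpow (s : ℝ) {v : E} (hv : v ∈ V) : opPow (Real.exp s) (B : E →L[ℝ] E) v ∈ V := by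
    intro A x h
    have h1 := hv _ _ (hX.map_conj_eq_conv_dirac h
      (t := ⟨Real.exp s, (Real.exp_pos s).le⟩) (Real.exp_pos s))
    rw [ContinuousLinearEquiv.trans_apply, ContinuousLinearEquiv.symm_apply_eq] at h1
    exact h1
  -- Under `A` both terms move by `Real.exp s • x`, so the shift cancels.
  have hVc (s : ℝ) : opPow (Real.exp s) (B : E →L[ℝ] E) c - Real.exp s • c ∈ V := by
    intro A x h
    have h1 := hcenter (hX.map_conj_eq_conv_dirac h
      (t := ⟨Real.exp s, (Real.exp_pos s).le⟩) (Real.exp_pos s))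
    rw [ContinuousLinearEquiv.trans_apply, ContinuousLinearEquiv.symm_apply_eq, map_add,
      ContinuousLinearEquiv.apply_symm_apply] at h1
    have h2 : A (opPow (Real.exp s) (B : E →L[ℝ] E) c) =
      opPow (Real.exp s) (B : E →L[ℝ] E) c + Real.exp s • x := h1
    rw [map_sub, map_smul, hcenter h, h2, smul_add]
    abel
  set D : E →ₗ[ℝ] E := ((B : E →L[ℝ] E) : E →ₗ[ℝ] E) - 1 with hD
  have hDv (v : E) : D v = B v - v := rfl
  have hDinj : Function.Injective D := by
    refine (injective_iff_map_eq_zero D).2 fun v hv => by_contra fun hne => hB ?_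
    exact Module.End.hasEigenvalue_of_hasEigenvector (x := v)
      ⟨Module.End.mem_eigenspace_iff.2 (by simpa [hDv, sub_eq_zero] using hv), hne⟩
  have hDV (v : E) (hv : v ∈ V) : D v ∈ V :=
    V.sub_mem (hasDerivAt_mem_submodule V (fun s => hVpow s hv) (hasDerivAt_opPow_exp_apply _ v)) hv
  have hDc : D c ∈ V := by
    refine hasDerivAt_mem_submodule V hVc (s := 0) ?_
    have h := (hasDerivAt_opPow_exp_apply (B : E →L[ℝ] E) c).sub
      ((Real.hasDerivAt_exp 0).smul_const c)
    rw [Real.exp_zero, one_smul] at h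
    exact h
  have hsurj : Function.Surjective (D.restrict hDV) := by
    refine LinearMap.injective_iff_surjective.1 fun u v huv => Subtype.ext (hDinj ?_)
    exact congrArg Subtype.val huv
  obtain ⟨v, hv⟩ := hsurj ⟨D c, hDc⟩
  have hvc : (v : E) = c := hDinj (congrArg Subtype.val hv)
  have hcV : c ∈ V := hvc ▸ v.2
  have h1 := hcenter hA
  rw [hcV A x hA] at h1
  simpa using h1

/-- For a Lévy process, the strict symmetries of the law of `X 1` are symmetries of the process. -/
theorem IsLevyProcess.processSymmetryGroup_eq (hX : IsLevyProcess X P) :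
    processSymmetryGroup X P = strictSymmetryGroup (P.map (X 1)) := by
  have hprob := hX.isProbabilityMeasure_map
  ext A
  constructor
  · intro h
    have h1 := ((h {1}).comp (measurable_pi_apply ⟨1, Finset.mem_singleton_self 1⟩)).map_eq
    change (P.map (X 1)).map A = P.map (X 1)
    rw [Measure.map_map (by fun_prop) (hX.measurable 1)]
    exact h1
  · intro h I
    have hmap (t : ℝ≥0) : (P.map (X t)).map A = P.map (X t) := by
      have h0 : (P.map (X 1)).map (A : E →L[ℝ] E) = (P.map (X 1)).conv (Measure.dirac 0) := by
        rw [Measure.conv_dirac_zero]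
        exact h
      have h1 := hX.map_eq_conv_dirac h0 t
      rw [smul_zero, Measure.conv_dirac_zero] at h1
      exact h1
    refine identDistrib_restrict_of_increments (hX.indep_increments.map (A : E →L[ℝ] E))
      hX.indep_increments (by filter_upwards [hX.zero] with ω hω; simp [hω]) hX.zero ?_ I
    intro s t hst
    obtain ⟨u, rfl⟩ := exists_add_of_le hst
    have hinc := hX.stationary_increments s u
    have hA : IdentDistrib (fun ω => A (X u ω)) (X u) P P :=
      ⟨(A.continuous.measurable.comp (hX.measurable u)).aemeasurable,
        (hX.measurable u).aemeasurable, by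
          conv_rhs => rw [← hmap u, Measure.map_map A.continuous.measurable (hX.measurable u)]
          rfl⟩
    have h1 := (hinc.comp A.continuous.measurable).trans (hA.trans hinc.symm)
    simpa [Function.comp_def] using h1

end Symmetry

end OperatorStable

theorem lemma6p1 {d : ℕ} {Ω : Type*} [MeasurableSpace Ω] (P : Measure Ω) [IsProbabilityMeasure P]
    (X : ℝ≥0 → Ω → EuclideanSpace ℝ (Fin d))
    (B : EuclideanSpace ℝ (Fin d) ≃L[ℝ] EuclideanSpace ℝ (Fin d))
    (hX : OperatorStable.IsStrictlyOperatorStable X P B)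
    (hfull : OperatorStable.IsFull (P.map (X 1)))
    (hB : ¬ Module.End.HasEigenvalue
      ((B : EuclideanSpace ℝ (Fin d) →L[ℝ] EuclideanSpace ℝ (Fin d)) :
        EuclideanSpace ℝ (Fin d) →ₗ[ℝ] EuclideanSpace ℝ (Fin d)) (1 : ℝ)) :
    OperatorStable.processSymmetryGroup X P = OperatorStable.symmetryGroup (P.map (X 1)) ∧
    OperatorStable.symmetryGroup (P.map (X 1)) =
      OperatorStable.strictSymmetryGroup (P.map (X 1)) := by
  have hS : OperatorStable.symmetryGroup (P.map (X 1)) =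
      OperatorStable.strictSymmetryGroup (P.map (X 1)) := by
    have := hX.levy.isProbabilityMeasure_map 1
    ext A
    constructor
    · rintro ⟨x, hx⟩
      obtain rfl := hX.shift_eq_zero hfull hB hx
      rwa [Measure.conv_dirac_zero] at hx
    · intro h
      exact ⟨0, by rw [Measure.conv_dirac_zero]; exact h⟩
  exact ⟨hX.levy.processSymmetryGroup_eq.trans hS.symm, hS⟩
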